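/- An ordered Bratteli diagram consists of finite vertex sets $V_0=\{v_0\},V_1,V_2,\dots$, finite edge sets $E_k$ ($k\ge 1$) joining vertices of $V_{k-1}$ to vertices of $V_k$, such that every vertex of $V_k$ is the end-point of an edge of $E_k$ ($k\ge1$) and the initial point of an edge of $E_{k+1}$ ($k\ge0$), and a partial order on each $E_k$ for which two edges are comparable if and only if they have the same end-point. Let $X_B$ be the space of infinite paths $(e_1,e_2,\dots)$ starting at $v_0$, with the topology generated by the cylinder sets. The diagram is properly ordered if there are exactly one path $x_{\max}$ with all edges maximal and exactly one path $x_{\min}$ with all edges minimal. Then the Vershik map $V_B:X_B\to X_B$ sends $x_{\max}$ to $x_{\min}$ and sends $x=(x_i)\ne x_{\max}$, with $k$ the least index such that $x_k$ is not maximal, to $(y_1,\dots,y_{k-1},y_k,x_{k+1},\dots)$, where $y_k$ is the successor of $x_k$ and $(y_1,\dots,y_{k-1})$ is the path with minimal edges from $v_0$ to the initial point of $y_k$. The diagram is of Toeplitz type if, for each $n\ge 1$, the number of edges in $E_n$ with end-point $u\in V_n$ does not depend on $u$. Theorem. Let $(X,T)$ be a Cantor minimal system, that is, $T$ is a homeomorphism,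 all of whose orbits are dense, of a nonempty compact Hausdorff space $X$ that has a countable basis of clopen sets and no isolated points. Let $d$ be a natural number, and suppose that $(X,T)$ is of Toeplitz type and finite rank $d$, that is, $(X,T)$ is topologically conjugate to $(X_B,V_B)$ for a properly ordered Bratteli diagram $B$ of Toeplitz type with at most $d$ vertices in each level $V_n$, $n\ge1$. Let $\mu$ be a $T$-ergodic Borel probability measure on $X$. Then all measurable eigenvalues of $(X,T,\mu)$ are rational: if $\exp(2i\pi\alpha)$, $\alpha\in\mathbb R$, is an eigenvalue, that is, if there is a nonzero $f\in L^2(X,\mu)$ with $f\circ T=\exp(2i\pi\alpha) f$ $\mu$-almost everywhere, then $\alpha$ is rational; moreover, every $z\in\mathbb C$ for which there is a nonzero $f\in L^2(X,\mu)$ with $f\circ T=zf$ $\mu$-almost everywhere is of the form $z=\exp(2i\pi q)$ with $q\in\mathbb Q$. -/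

import Mathlib

open MeasureTheory

noncomputable section

/-- An ordered Bratteli diagram. The edge set `E n` joins the vertices in `V n` to those in
`V (n + 1)`, so it is the set usually written `E_{n+1}`. -/
structure OrderedBratteliDiagram where
  /-- the vertices of level `n` -/
  V : ℕ → Type
  /-- the edges between the levels `n` and `n + 1` -/
  E : ℕ → Type
  fintypeV : ∀ n, Fintype (V n)
  fintypeE : ∀ n, Fintype (E n)
  /-- level `0` consists of a single vertex -/
  root : Unique (V 0)
  /-- initial vertex of an edge -/
  src : ∀ {n}, E n → V n
  /-- end-point of an edge -/
  tgt : ∀ {n}, E n → V (n + 1)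
  src_surjective : ∀ n, Function.Surjective (src : E n → V n)
  tgt_surjective : ∀ n, Function.Surjective (tgt : E n → V (n + 1))
  /-- the partial order on the edges -/
  order : ∀ n, PartialOrder (E n)
  /-- two edges are comparable if and only if they have the same end-point -/
  comparable_iff : ∀ {n} (e e' : E n), (e ≤ e' ∨ e' ≤ e) ↔ tgt e = tgt e'

namespace OrderedBratteliDiagram

attribute [instance] fintypeV fintypeE root order

variable (B : OrderedBratteliDiagram)

/-- The space `X_B` of infinite paths; they start at the only vertex of level `0`. -/
@[ext]
structure PathSpace where
  /-- the edges of the path -/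
  edge : ∀ n, B.E n
  /-- consecutive edges fit together -/
  tgt_edge : ∀ n, B.tgt (edge n) = B.src (edge (n + 1))

/-- The cylinder set `[x_1, …, x_k]`. -/
def cylinder (x : B.PathSpace) (k : ℕ) : Set B.PathSpace :=
  {y | ∀ i < k, y.edge i = x.edge i}

/-- The topology of `X_B`, generated by the cylinder sets. -/
instance : TopologicalSpace B.PathSpace :=
  TopologicalSpace.generateFrom {U | ∃ x k, U = B.cylinder x k}

/-- All edges of the path are maximal (among the edges with the same end-point). -/
def IsMaxPath (x : B.PathSpace) : Prop := ∀ n, IsMax (x.edge n)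

/-- All edges of the path are minimal (among the edges with the same end-point). -/
def IsMinPath (x : B.PathSpace) : Prop := ∀ n, IsMin (x.edge n)

/-- There are exactly one maximal path and exactly one minimal path. -/
def ProperlyOrdered : Prop :=
  (∃! x, B.IsMaxPath x) ∧ ∃! x, B.IsMinPath x

variable {B}

theorem exists_isMin_tgt {n : ℕ} (v : B.V (n + 1)) : ∃ e : B.E n, IsMin e ∧ B.tgt e = v := by
  obtain ⟨e, he⟩ := B.tgt_surjective n v
  obtain ⟨m, hm, hmin⟩ := (Set.toFinite (Set.univ : Set (B.E n))).exists_le_minimal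
    (Set.mem_univ e)
  refine ⟨m, fun b hb => hmin.2 (Set.mem_univ b) hb, ?_⟩
  rw [← he]
  exact (B.comparable_iff m e).1 (Or.inl hm)

theorem exists_covBy {n : ℕ} (e : B.E n) (he : ¬ IsMax e) : ∃ e' : B.E n, e ⋖ e' := by
  obtain ⟨b, hb⟩ := not_isMax_iff.1 he
  obtain ⟨c, hc, -⟩ := exists_covBy_le_of_lt hb
  exact ⟨c, hc⟩

/-- The minimal edge with end-point `v`. -/
def minEdge {n : ℕ} (v : B.V (n + 1)) : B.E n := (exists_isMin_tgt v).choose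

theorem minEdge_isMin {n : ℕ} (v : B.V (n + 1)) : IsMin (minEdge v) :=
  (exists_isMin_tgt v).choose_spec.1

theorem tgt_minEdge {n : ℕ} (v : B.V (n + 1)) : B.tgt (minEdge v) = v :=
  (exists_isMin_tgt v).choose_spec.2

/-- The successor of a non-maximal edge. -/
def succEdge {n : ℕ} (e : B.E n) (he : ¬ IsMax e) : B.E n := (exists_covBy e he).choose

theorem covBy_succEdge {n : ℕ} (e : B.E n) (he : ¬ IsMax e) : e ⋖ succEdge e he :=
  (exists_covBy e he).choose_spec

theorem tgt_succEdge {n : ℕ} (e : B.E n) (he : ¬ IsMax e) : B.tgt (succEdge e he) = B.tgt e :=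
  ((B.comparable_iff _ _).1 (Or.inl (covBy_succEdge e he).le)).symm

/-- Replace the edges of `x` below level `k` by the minimal path from the root to `v`. -/
def prependMin (x : ∀ n, B.E n) : (k : ℕ) → B.V k → ∀ n, B.E n
  | 0, _ => x
  | k + 1, v => Function.update (prependMin x k (B.src (minEdge v))) k (minEdge v)

theorem prependMin_of_le (x : ∀ n, B.E n) :
    ∀ (k : ℕ) (v : B.V k) (n : ℕ), k ≤ n → prependMin x k v n = x n
  | 0, _, _, _ => rfl
  | k + 1, v, n, h => by
    rw [prependMin, Function.update_of_ne (by omega)]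
    exact prependMin_of_le x k _ n (by omega)

theorem tgt_prependMin (x : ∀ n, B.E n) : ∀ (k : ℕ) (v : B.V (k + 1)),
    B.tgt (prependMin x (k + 1) v k) = v := by
  intro k v
  rw [prependMin, Function.update_self, tgt_minEdge]

theorem prependMin_path (x : ∀ n, B.E n) : ∀ (k : ℕ) (v : B.V k), v = B.src (x k) →
    (∀ n, k ≤ n → B.tgt (x n) = B.src (x (n + 1))) →
    ∀ n, B.tgt (prependMin x k v n) = B.src (prependMin x k v (n + 1)) := by
  suffices H : ∀ (k : ℕ) (v : B.V k), ∀ n, n + 1 < k →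
      B.tgt (prependMin x k v n) = B.src (prependMin x k v (n + 1)) by
    intro k v hv hx n
    rcases lt_trichotomy (n + 1) k with h | h | h
    · exact H k v n h
    · subst h
      rw [tgt_prependMin, prependMin_of_le x _ _ _ le_rfl, hv]
    · rw [prependMin_of_le x _ _ _ (by omega), prependMin_of_le x _ _ _ (by omega)]
      exact hx n (by omega)
  intro k
  induction k with
  | zero => intro v n h; omega
  | succ k ih =>
    intro v n h
    rw [prependMin, Function.update_of_ne (show n ≠ k by omega)]
    by_cases hn : n + 1 = k
    · subst hn
      rw [Function.update_self, tgt_prependMin]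
    · rw [Function.update_of_ne hn]
      exact ih _ n (by omega)

theorem vershikStep_path (x : B.PathSpace) (k : ℕ) (hk : ¬ IsMax (x.edge k)) (n : ℕ) :
    B.tgt (prependMin (Function.update x.edge k (succEdge (x.edge k) hk)) k
        (B.src (succEdge (x.edge k) hk)) n) =
      B.src (prependMin (Function.update x.edge k (succEdge (x.edge k) hk)) k
        (B.src (succEdge (x.edge k) hk)) (n + 1)) := by
  refine prependMin_path _ k _ (by rw [Function.update_self]) ?_ n
  intro n hn
  rw [Function.update_of_ne (show n + 1 ≠ k by omega)]
  by_cases h : n = k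
  · subst h
    rw [Function.update_self, tgt_succEdge]
    exact x.tgt_edge n
  · rw [Function.update_of_ne h]
    exact x.tgt_edge n

open Classical in
/-- The Vershik map `V_B` of a properly ordered Bratteli diagram. If `k` is the first level at
which `x` has a non-maximal edge, this edge is replaced by its successor, the edges before it by
the minimal path to the initial vertex of the successor, and the later edges are kept. The maximal
path is sent to the minimal path. -/
def vershikMap (hB : B.ProperlyOrdered) (x : B.PathSpace) : B.PathSpace :=
  if h : ∃ k, ¬ IsMax (x.edge k) then
    ⟨prependMin (Function.update x.edge (Nat.find h) (succEdge (x.edge (Nat.find h)) (Nat.find_spec h)))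
        (Nat.find h) (B.src (succEdge (x.edge (Nat.find h)) (Nat.find_spec h))),
      vershikStep_path x (Nat.find h) (Nat.find_spec h)⟩
  else hB.2.choose

variable (B)

/-- A diagram of Toeplitz type: at each level the number of edges with end-point `u` does not
depend on `u`. -/
def IsToeplitz : Prop :=
  ∀ (n : ℕ) (u v : B.V (n + 1)),
    Nat.card {e : B.E n // B.tgt e = u} = Nat.card {e : B.E n // B.tgt e = v}

/-- There are at most `d` vertices at each level. -/
def RankLE (d : ℕ) : Prop := ∀ n, Nat.card (B.V (n + 1)) ≤ d

end OrderedBratteliDiagram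

/-- `T` is a minimal homeomorphism of a Cantor set: a nonempty compact Hausdorff space with a
countable basis of closed and open sets and without isolated points. -/
structure IsCantorMinimal {X : Type*} [TopologicalSpace X] (T : X ≃ₜ X) : Prop where
  nonempty : Nonempty X
  compact : CompactSpace X
  hausdorff : T2Space X
  clopen_basis : ∃ b : Set (Set X), b.Countable ∧ TopologicalSpace.IsTopologicalBasis b ∧
    ∀ U ∈ b, IsClopen U
  no_isolated : ∀ x : X, ¬ IsOpen ({x} : Set X)
  minimal : ∀ x : X, Dense (Set.range fun n : ℤ => (T ^ n) x)

/-- `(X, T)` is of Toeplitz type and rank at most `d`: it is topologically conjugate to the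
Bratteli-Vershik system of a properly ordered diagram of Toeplitz type with at most `d` vertices
per level. -/
def IsToeplitzOfRank {X : Type*} [TopologicalSpace X] (T : X ≃ₜ X) (d : ℕ) : Prop :=
  ∃ (B : OrderedBratteliDiagram) (hB : B.ProperlyOrdered) (h : B.PathSpace ≃ₜ X),
    B.IsToeplitz ∧ B.RankLE d ∧ ∀ x, h (B.vershikMap hB x) = T (h x)

/-- `z` is an eigenvalue of `T` with respect to `μ`: there is a nonzero `f` in `L²(μ)` with
`f ∘ T = z f`. -/
def IsMeasurableEigenvalue {X : Type*} [MeasurableSpace X] (T : X → X) (μ : Measure X)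
    (z : ℂ) : Prop :=
  ∃ f : X → ℂ, MemLp f 2 μ ∧ ¬ f =ᵐ[μ] 0 ∧ f ∘ T =ᵐ[μ] fun x => z * f x

end

/-! In a diagram of Toeplitz type all vertices of level `n` carry the same number `height n` of
paths from the root. Numbering these paths by `position`, the Vershik map adds one modulo `height n`
(`IsToeplitz.position_vershikMap`), so the iterates at multiples of `height n` preserve the
position, and a point's first `n` edges are then determined by its vertex alone.

Let `f` be an eigenfunction for an irrational `α`. By ergodicity `|f| = c > 0` a.e., and `f` is
close to a continuous `g` off a set of small measure. At a deep level, `g` nearly depends only on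
the initial edges. The powers of `exp (2πiα · height)` are dense in the circle, so there are `d + 1`
multiples of the height at which the eigenvalue takes uniformly separated values. Some point `x`
avoids the bad set at all these times, and two of the `d + 1` iterates share a vertex, hence their
initial edges. There `f` takes nearly equal values, although they differ by the factor between two
separated powers: a contradiction. -/

namespace OrderedBratteliDiagram

/-! ### Ranks of edges with a common end-point -/

variable {B : OrderedBratteliDiagram}

/-- The number of edges that precede `e`. -/
noncomputable def rank {n : ℕ} (e : B.E n) : ℕ := {e' : B.E n | e' < e}.ncard

theorem ncard_Iic {n : ℕ} (e : B.E n) : {e' : B.E n | e' ≤ e}.ncard = rank e + 1 := by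
  have h : {e' : B.E n | e' ≤ e} = insert e {e' : B.E n | e' < e} := by
    ext x
    simp [le_iff_eq_or_lt]
  rw [h, Set.ncard_insert_of_notMem (by simp), rank]

theorem tgt_eq_of_le {n : ℕ} {e e' : B.E n} (h : e ≤ e') : B.tgt e = B.tgt e' :=
  (B.comparable_iff e e').1 (Or.inl h)

theorem rank_lt_rank {n : ℕ} {e e' : B.E n} (h : e < e') : rank e < rank e' :=
  Set.ncard_lt_ncard ⟨fun _ hx => lt_trans hx h, fun hs => lt_irrefl e (hs h)⟩

theorem eq_of_rank_eq {n : ℕ} {e e' : B.E n} (ht : B.tgt e = B.tgt e') (hr : rank e = rank e') :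
    e = e' := by
  rcases (B.comparable_iff e e').2 ht with h | h
  · exact h.eq_or_lt.resolve_right fun h => (rank_lt_rank h).ne hr
  · exact (h.eq_or_lt.resolve_right fun h => (rank_lt_rank h).ne hr.symm).symm

theorem rank_of_isMin {n : ℕ} {e : B.E n} (h : IsMin e) : rank e = 0 := by
  rw [rank, Set.ncard_eq_zero]
  ext x
  simpa using h.not_lt

theorem rank_succEdge {n : ℕ} (e : B.E n) (he : ¬ IsMax e) :
    rank (succEdge e he) = rank e + 1 := by
  have hc := covBy_succEdge e he
  rw [← ncard_Iic, rank]
  congr 1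
  ext x
  refine ⟨fun (hx : x < _) => ?_, fun (hx : x ≤ e) => hx.trans_lt hc.lt⟩
  rcases (B.comparable_iff x e).2 ((tgt_eq_of_le hx.le).trans (tgt_succEdge e he)) with h | h
  · exact h
  · exact (h.eq_or_lt.resolve_right fun h => hc.2 h hx).ge

variable (B) in
theorem nonempty_V : ∀ n, Nonempty (B.V n)
  | 0 => ⟨default⟩
  | n + 1 => by
    obtain ⟨v⟩ := nonempty_V n
    obtain ⟨e, -⟩ := B.src_surjective n v
    exact ⟨B.tgt e⟩

variable (B) in
/-- The number of edges with a given end-point in a diagram of Toeplitz type. -/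
noncomputable def width (n : ℕ) : ℕ := Nat.card {e : B.E n // B.tgt e = (B.nonempty_V (n + 1)).some}

theorem IsToeplitz.ncard_fiber (hB : B.IsToeplitz) {n : ℕ} (v : B.V (n + 1)) :
    {e : B.E n | B.tgt e = v}.ncard = B.width n := hB n _ _

theorem IsToeplitz.rank_lt (hB : B.IsToeplitz) {n : ℕ} (e : B.E n) : rank e < B.width n := by
  rw [← hB.ncard_fiber (B.tgt e), Nat.lt_iff_add_one_le, ← ncard_Iic]
  exact Set.ncard_le_ncard fun x hx => tgt_eq_of_le hx

theorem IsToeplitz.rank_of_isMax (hB : B.IsToeplitz) {n : ℕ} {e : B.E n} (he : IsMax e) :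
    rank e + 1 = B.width n := by
  rw [← hB.ncard_fiber (B.tgt e), ← ncard_Iic]
  congr 1
  ext x
  refine ⟨fun hx => tgt_eq_of_le hx, fun hx => ?_⟩
  rcases (B.comparable_iff x e).2 hx with h | h
  · exact h
  · exact he h

/-! ### Heights and positions: the odometer coordinate -/

variable (B) in
/-- The number of paths from the root to a given vertex of level `n` in a diagram of Toeplitz
type. -/
noncomputable def height (n : ℕ) : ℕ := ∏ i ∈ Finset.range n, B.width i

theorem height_succ (n : ℕ) : B.height (n + 1) = B.height n * B.width n :=
  Finset.prod_range_succ _ _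

theorem IsToeplitz.height_pos (hB : B.IsToeplitz) (n : ℕ) : 0 < B.height n := by
  refine Finset.prod_pos fun i _ => ?_
  obtain ⟨v⟩ := B.nonempty_V i
  obtain ⟨e, -⟩ := B.src_surjective i v
  exact (Nat.zero_le _).trans_lt (hB.rank_lt e)

/-- The position of a path among the finite paths with the same vertex at level `n`. -/
noncomputable def position (x : ∀ n, B.E n) (n : ℕ) : ℕ := ∑ i ∈ Finset.range n, rank (x i) * B.height i

theorem position_succ (x : ∀ n, B.E n) (n : ℕ) :
    position x (n + 1) = position x n + rank (x n) * B.height n :=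
  Finset.sum_range_succ _ _

theorem IsToeplitz.position_lt (hB : B.IsToeplitz) (x : ∀ n, B.E n) (n : ℕ) :
    position x n < B.height n := by
  induction n with
  | zero => simp [position, height]
  | succ n ih =>
    rw [position_succ, height_succ]
    have := Nat.mul_le_mul_left (B.height n) (hB.rank_lt (x n))
    rw [Nat.succ_eq_add_one, mul_add, mul_one] at this
    rw [mul_comm (rank _)]
    omega

/-- `position` is a mixed-radix expansion whose digits are the ranks. Its top digit and the end
vertex determine the last edge, whose source is the end vertex for the remaining digits. -/
theorem IsToeplitz.edge_eq_of_position_eq (hB : B.IsToeplitz) (x y : B.PathSpace) (n : ℕ)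
    (hv : B.src (x.edge n) = B.src (y.edge n))
    (hp : position x.edge n = position y.edge n) : ∀ i < n, x.edge i = y.edge i := by
  induction n with
  | zero => intro i hi; omega
  | succ n ih =>
    rw [position_succ, position_succ] at hp
    have hr : rank (x.edge n) = rank (y.edge n) := by
      have := congrArg (· / B.height n) hp
      simpa [Nat.add_mul_div_right _ _ (hB.height_pos n),
        Nat.div_eq_of_lt (hB.position_lt _ n)] using this
    have he : x.edge n = y.edge n :=
      eq_of_rank_eq (by rw [x.tgt_edge, y.tgt_edge, hv]) hr
    intro i hi
    rcases Nat.lt_succ_iff_lt_or_eq.1 hi with hi | rfl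
    · exact ih (by rw [he]) (by rw [hr] at hp; omega) i hi
    · exact he

theorem IsToeplitz.position_of_isMax (hB : B.IsToeplitz) (x : ∀ n, B.E n) (n : ℕ)
    (hx : ∀ i < n, IsMax (x i)) : position x n + 1 = B.height n := by
  induction n with
  | zero => simp [position, height]
  | succ n ih =>
    rw [position_succ, height_succ, ← hB.rank_of_isMax (hx n (by omega)),
      ← ih fun i hi => hx i (by omega)]
    ring

theorem position_of_isMin (x : ∀ n, B.E n) (n : ℕ) (hx : ∀ i < n, IsMin (x i)) :
    position x n = 0 :=
  Finset.sum_eq_zero fun i hi => by rw [rank_of_isMin (hx i (Finset.mem_range.1 hi)), zero_mul]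

theorem isMin_prependMin (x : ∀ n, B.E n) : ∀ (k : ℕ) (v : B.V k) (i : ℕ), i < k →
    IsMin (prependMin x k v i)
  | k + 1, v, i, hi => by
    rw [prependMin]
    rcases Nat.lt_succ_iff_lt_or_eq.1 hi with hi | rfl
    · rw [Function.update_of_ne hi.ne]
      exact isMin_prependMin x k _ i hi
    · rw [Function.update_self]
      exact minEdge_isMin v

/-- This is addition of one with carry: maximal digits reset to zero and the first non-maximal digit
increases by one. The congruence is strict only on overflow, when the first `n` edges are all
maximal. -/
theorem IsToeplitz.position_vershikMap (ht : B.IsToeplitz) (hB : B.ProperlyOrdered)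
    (x : B.PathSpace) (n : ℕ) :
    position (B.vershikMap hB x).edge n ≡ position x.edge n + 1 [MOD B.height n] := by
  have top (hx : ∀ i < n, IsMax (x.edge i)) (hy : ∀ i < n, IsMin ((B.vershikMap hB x).edge i)) :
      position (B.vershikMap hB x).edge n ≡ position x.edge n + 1 [MOD B.height n] := by
    rw [ht.position_of_isMax _ n hx, position_of_isMin _ n hy]
    exact (Nat.modEq_zero_iff_dvd.2 dvd_rfl).symm
  classical
  by_cases h : ∃ k, ¬ IsMax (x.edge k)
  · have hmin : ∀ i < Nat.find h, IsMin ((B.vershikMap hB x).edge i) := by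
      intro i hi
      rw [vershikMap, dif_pos h]
      exact isMin_prependMin _ _ _ _ hi
    have hmax : ∀ i < Nat.find h, IsMax (x.edge i) := fun i hi => not_not.1 (Nat.find_min h hi)
    have hfind : rank ((B.vershikMap hB x).edge (Nat.find h)) = rank (x.edge (Nat.find h)) + 1 := by
      rw [vershikMap, dif_pos h, ← rank_succEdge _ (Nat.find_spec h)]
      simp only [prependMin_of_le _ _ _ _ le_rfl, Function.update_self]
    have hlater : ∀ i, Nat.find h < i → (B.vershikMap hB x).edge i = x.edge i := by
      intro i hi
      rw [vershikMap, dif_pos h]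
      simp only [prependMin_of_le _ _ _ _ hi.le, Function.update_of_ne hi.ne']
    generalize Nat.find h = k at *
    rcases le_or_gt n k with hn | hn
    · exact top (fun i hi => hmax i (by omega)) fun i hi => hmin i (by omega)
    · obtain ⟨m, rfl⟩ := Nat.exists_eq_add_of_le (Nat.succ_le_of_lt hn)
      -- Beyond level `k` the carry has been absorbed, so equality holds without the modulus.
      suffices position (B.vershikMap hB x).edge (k.succ + m) = position x.edge (k.succ + m) + 1 by
        rw [this]
      induction m with
      | zero =>
        rw [add_zero, Nat.succ_eq_add_one, position_succ, position_succ, hfind,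
          position_of_isMin _ k hmin, add_mul, one_mul, ← ht.position_of_isMax _ k hmax]
        ring
      | succ m ih =>
        rw [← add_assoc, position_succ, position_succ, ih ?_ (by omega), hlater _ (by omega)]
        · ring
        · intro hx hy
          rw [ht.position_of_isMax _ _ hx, position_of_isMin _ _ hy]
          exact (Nat.modEq_zero_iff_dvd.2 dvd_rfl).symm
  · have hx : ∀ i, IsMax (x.edge i) := by
      simpa only [not_exists, not_not] using h
    refine top (fun i _ => hx i) fun i _ => ?_
    rw [vershikMap, dif_neg h]
    exact hB.2.choose_spec.1 i

theorem IsToeplitz.position_iterate_vershikMap (ht : B.IsToeplitz) (hB : B.ProperlyOrdered)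
    (x : B.PathSpace) (n k : ℕ) :
    position ((B.vershikMap hB)^[k * B.height n] x).edge n = position x.edge n := by
  have key (m : ℕ) : position ((B.vershikMap hB)^[m] x).edge n ≡ position x.edge n + m
      [MOD B.height n] := by
    induction m with
    | zero => rfl
    | succ m ih =>
      rw [Function.iterate_succ_apply', ← add_assoc]
      exact (ht.position_vershikMap hB _ n).trans (ih.add_right 1)
  refine Nat.ModEq.eq_of_lt_of_lt ((key _).trans ?_) (ht.position_lt _ n) (ht.position_lt _ n)
  simp [Nat.ModEq]

/-! ### Cylinders and uniform continuity on the path space -/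

theorem exists_cylinder_subset (x : B.PathSpace) {U : Set B.PathSpace} (hU : IsOpen U)
    (hx : x ∈ U) : ∃ k, B.cylinder x k ⊆ U := by
  induction hU with
  | basic U hU =>
    obtain ⟨y, k, rfl⟩ := hU
    exact ⟨k, fun z hz i hi => (hz i hi).trans (hx i hi)⟩
  | univ => exact ⟨0, Set.subset_univ _⟩
  | inter U V _ _ hU hV =>
    obtain ⟨k, hk⟩ := hU hx.1
    obtain ⟨l, hl⟩ := hV hx.2
    exact ⟨max k l, fun z hz => ⟨hk fun i hi => hz i (lt_max_of_lt_left hi),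
      hl fun i hi => hz i (lt_max_of_lt_right hi)⟩⟩
  | sUnion S _ hS =>
    obtain ⟨U, hU, hxU⟩ := hx
    obtain ⟨k, hk⟩ := hS U hU hxU
    exact ⟨k, hk.trans (Set.subset_sUnion_of_mem hU)⟩

theorem isOpen_cylinder (x : B.PathSpace) (k : ℕ) : IsOpen (B.cylinder x k) :=
  TopologicalSpace.isOpen_generateFrom_of_mem ⟨x, k, rfl⟩

theorem exists_level_dist_lt [CompactSpace B.PathSpace] {Y : Type*} [PseudoMetricSpace Y]
    {g : B.PathSpace → Y} (hg : Continuous g) {ε : ℝ} (hε : 0 < ε) :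
    ∃ n, ∀ m, n ≤ m → ∀ x y : B.PathSpace, (∀ i < m, x.edge i = y.edge i) →
      dist (g x) (g y) < ε := by
  have loc (x : B.PathSpace) : ∃ k, B.cylinder x k ⊆ g ⁻¹' Metric.ball (g x) (ε / 2) :=
    exists_cylinder_subset x (Metric.isOpen_ball.preimage hg) (by simpa using half_pos hε)
  choose k hk using loc
  obtain ⟨t, ht⟩ := isCompact_univ.elim_finite_subcover (fun x => B.cylinder x (k x))
    (fun x => isOpen_cylinder x _) fun x _ => Set.mem_iUnion.2 ⟨x, fun _ _ => rfl⟩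
  refine ⟨t.sup k, fun m hm x y hxy => ?_⟩
  obtain ⟨z, hz, hxz⟩ := Set.mem_iUnion₂.1 (ht (Set.mem_univ x))
  have hyz : y ∈ B.cylinder z (k z) := fun i hi =>
    (hxy i (hi.trans_le ((Finset.le_sup hz).trans hm))).symm.trans (hxz i hi)
  have h1 : dist (g x) (g z) < ε / 2 := hk z hxz
  have h2 : dist (g y) (g z) < ε / 2 := hk z hyz
  linarith [dist_triangle_right (g x) (g y) (g z)]

end OrderedBratteliDiagram

/-! ### Separated points in dense orbits of the circle -/

theorem exists_pos_le_dist_of_injective {ι Y : Type*} [Finite ι] [MetricSpace Y] {p : ι → Y}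
    (hp : Function.Injective p) : ∃ r > 0, ∀ i j, i ≠ j → r ≤ dist (p i) (p j) := by
  rcases isEmpty_or_nonempty {q : ι × ι // q.1 ≠ q.2} with h | h
  · exact ⟨1, one_pos, fun i j hij => (h.false ⟨(i, j), hij⟩).elim⟩
  · obtain ⟨q, hq⟩ := Finite.exists_min fun q : {q : ι × ι // q.1 ≠ q.2} => dist (p q.1.1) (p q.1.2)
    exact ⟨_, dist_pos.2 (hp.ne q.2), fun i j hij => hq ⟨(i, j), hij⟩⟩

theorem DenseRange.exists_le_dist {ι Y K : Type*} [PseudoMetricSpace Y] {u : K → Y}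
    (hu : DenseRange u) {p : ι → Y} {r : ℝ} (hr : 0 < r)
    (hp : ∀ i j, i ≠ j → r ≤ dist (p i) (p j)) :
    ∃ k : ι → K, ∀ i j, i ≠ j → r / 2 ≤ dist (u (k i)) (u (k j)) := by
  choose k hk using fun i => hu.exists_dist_lt (p i) (show 0 < r / 4 by positivity)
  refine ⟨k, fun i j hij => ?_⟩
  have h1 := dist_triangle4 (p i) (u (k i)) (u (k j)) (p j)
  have h2 := hk j
  rw [dist_comm] at h2
  linarith [hp i j hij, hk i]

theorem Circle.infinite : Infinite Circle :=
  have : Infinite (Set.Icc (0 : ℝ) 1) := (Set.Icc_infinite one_pos).to_subtype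
  Infinite.of_injective (fun x : Set.Icc (0 : ℝ) 1 => Circle.exp x)
    (Circle.exp_injOn_Icc (by linarith [Real.pi_gt_three])).injective

theorem denseRange_circleExp_pow {β : ℝ} (hβ : Irrational β) :
    DenseRange fun k : ℕ => Circle.exp (2 * Real.pi * β) ^ k := by
  have h : DenseRange (· • β : ℕ → AddCircle (1 : ℝ)) :=
    denseRange_zsmul_iff_nsmul.1 (AddCircle.denseRange_zsmul_coe_iff.2 (by simpa using hβ))
  have hs : Function.Surjective (AddCircle.toCircle : AddCircle (1 : ℝ) → Circle) :=
    funext (AddCircle.homeomorphCircle_apply (one_ne_zero (α := ℝ))) ▸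
      (AddCircle.homeomorphCircle one_ne_zero).surjective
  have := hs.denseRange.comp h AddCircle.continuous_toCircle
  convert! this using 2 with k
  simp [AddCircle.toCircle_nsmul, AddCircle.toCircle_apply_mk]

/-! ### Eigenfunctions of measure-preserving maps -/

section Eigenfunction

variable {X : Type*} [MeasurableSpace X] {T : X → X} {μ : Measure X} {f : X → ℂ} {z : ℂ}

theorem norm_eigenvalue_eq_one (hT : MeasurePreserving T μ μ) (hf : MemLp f 2 μ)
    (h0 : ¬ f =ᵐ[μ] 0) (hz : f ∘ T =ᵐ[μ] fun x => z * f x) : ‖z‖ = 1 := by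
  have h1 : eLpNorm (f ∘ T) 2 μ = eLpNorm f 2 μ := eLpNorm_comp_measurePreserving hf.1 hT
  have h2 : eLpNorm (z • f) 2 μ = ‖z‖ₑ * eLpNorm f 2 μ := eLpNorm_const_smul _ _ _ _
  rw [eLpNorm_congr_ae hz] at h1
  have h3 : ‖z‖ₑ * eLpNorm f 2 μ = 1 * eLpNorm f 2 μ := by rw [one_mul, ← h2, ← h1]; rfl
  have hne : eLpNorm f 2 μ ≠ 0 := fun h => h0 ((eLpNorm_eq_zero_iff hf.1 two_ne_zero).1 h)
  have h4 := (ENNReal.mul_left_inj hne hf.2.ne).1 h3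
  simpa [enorm_eq_nnnorm, ← NNReal.coe_inj] using h4

theorem exists_norm_eigenfunction_eq (hT : Ergodic T μ) (hf : AEStronglyMeasurable f μ)
    (h0 : ¬ f =ᵐ[μ] 0) (hz1 : ‖z‖ = 1) (hz : f ∘ T =ᵐ[μ] fun x => z * f x) :
    ∃ c > 0, ∀ᵐ x ∂μ, ‖f x‖ = c := by
  obtain ⟨c, hc⟩ := hT.quasiErgodic.ae_eq_const_of_ae_eq_comp_ae hf.norm (by
    filter_upwards [hz] with x hx
    simpa [hz1] using congrArg norm hx)
  refine ⟨c, lt_of_not_ge fun h => h0 ?_, hc⟩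
  filter_upwards [hc] with x hx
  exact norm_le_zero_iff.1 (hx.le.trans h)

theorem eigenfunction_iterate (hT : MeasurePreserving T μ μ)
    (hz : f ∘ T =ᵐ[μ] fun x => z * f x) : ∀ᵐ x ∂μ, ∀ m : ℕ, f (T^[m] x) = z ^ m * f x := by
  have h : ∀ᵐ x ∂μ, ∀ m : ℕ, f (T (T^[m] x)) = z * f (T^[m] x) :=
    ae_all_iff.2 fun m => (hT.iterate m).quasiMeasurePreserving.ae hz
  filter_upwards [h] with x hx m
  induction m with
  | zero => simp
  | succ m ih => rw [Function.iterate_succ_apply', hx, ih, pow_succ]; ring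

end Eigenfunction

/-- Union bound: the preimages of `A` all have measure `μ A`, so they cannot cover almost
everything. -/
theorem exists_forall_iterate_notMem {X ι : Type*} [Fintype ι] [MeasurableSpace X] {T : X → X}
    {μ : Measure X} [IsProbabilityMeasure μ] (hT : MeasurePreserving T μ μ) {A : Set X}
    (hA : NullMeasurableSet A μ) (hμA : Fintype.card ι * μ A < 1) (k : ι → ℕ) {P : X → Prop}
    (hP : ∀ᵐ x ∂μ, P x) : ∃ x, P x ∧ ∀ i, T^[k i] x ∉ A := by
  by_contra! h
  have h1 : μ Set.univ ≤ μ (⋃ i, T^[k i] ⁻¹' A) :=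
    measure_mono_ae (by
      filter_upwards [hP] with x hx _
      obtain ⟨i, hi⟩ := h x hx
      exact Set.mem_iUnion.2 ⟨i, hi⟩)
  have h2 : μ (⋃ i, T^[k i] ⁻¹' A) ≤ ∑ i, μ (T^[k i] ⁻¹' A) := measure_iUnion_fintype_le _ _
  simp only [(hT.iterate _).measure_preimage hA, Finset.sum_const, Finset.card_univ,
    nsmul_eq_mul] at h2
  rw [measure_univ] at h1
  exact absurd (h1.trans h2) hμA.not_ge

/-- Density of bounded continuous functions in `L¹`, combined with Markov's inequality. -/
theorem exists_continuous_measure_lt {X : Type*} [TopologicalSpace X] [NormalSpace X]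
    [MeasurableSpace X] [BorelSpace X] {μ : Measure X} [μ.WeaklyRegular]
    {f : X → ℂ} (hf : Integrable f μ) {ε : ℝ} (hε : 0 < ε) {δ : ENNReal} (hδ : δ ≠ 0) :
    ∃ g : X → ℂ, Continuous g ∧ NullMeasurableSet {x | ε ≤ dist (f x) (g x)} μ ∧
      μ {x | ε ≤ dist (f x) (g x)} ≤ δ := by
  have hε' : ENNReal.ofReal ε ≠ 0 := by simpa using hε
  obtain ⟨g, hg, hgi⟩ := hf.exists_boundedContinuous_lintegral_sub_le
    (ε := δ * ENNReal.ofReal ε) (mul_ne_zero hδ hε')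
  have hm := hf.1.sub hgi.1
  have hset : {x | ε ≤ dist (f x) (g x)} = {x | ENNReal.ofReal ε ≤ ‖f x - g x‖ₑ} := by
    ext x
    rw [Set.mem_ofPred_eq, Set.mem_ofPred_eq, ← ofReal_norm, dist_eq_norm,
      ENNReal.ofReal_le_ofReal_iff (norm_nonneg _)]
  refine ⟨g, g.continuous, ?_, ?_⟩
  · rw [hset]
    exact nullMeasurableSet_le aemeasurable_const hm.enorm
  · rw [hset]
    refine (meas_ge_le_lintegral_div hm.enorm hε' ENNReal.ofReal_ne_top).trans ?_
    exact ENNReal.div_le_of_le_mul hg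

open OrderedBratteliDiagram in
theorem IsToeplitzOfRank.not_irrational_of_isMeasurableEigenvalue {X : Type*} [TopologicalSpace X]
    [CompactSpace X] [NormalSpace X] [MeasurableSpace X] [BorelSpace X] {T : X ≃ₜ X} {d : ℕ}
    (hd : IsToeplitzOfRank T d) {μ : Measure X} [IsProbabilityMeasure μ] [μ.WeaklyRegular]
    (hμ : Ergodic T μ) {α : ℝ}
    (hα : IsMeasurableEigenvalue T μ (Circle.exp (2 * Real.pi * α))) : ¬ Irrational α := by
  intro hirr
  obtain ⟨B, hB, h, ht, hr, hconj⟩ := hd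
  obtain ⟨f, hf, h0, hz⟩ := hα
  have : CompactSpace B.PathSpace := h.symm.compactSpace
  obtain ⟨c, hc, hfc⟩ := exists_norm_eigenfunction_eq hμ hf.1 h0 (Circle.norm_coe _) hz
  have hiter := eigenfunction_iterate hμ.toMeasurePreserving hz
  have := Circle.infinite
  -- The separation `r` comes from `d + 1` fixed points of the circle, before the level `n` is
  -- chosen: `n` depends on the tolerance `c * r / 8`, hence on `r`.
  obtain ⟨r, hr0, hp⟩ := exists_pos_le_dist_of_injective
    (Infinite.natEmbedding Circle |>.injective.comp (Fin.val_injective (n := d + 1)))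
  have hε : 0 < c * r / 8 := by positivity
  obtain ⟨g, hg, hA, hμA⟩ := exists_continuous_measure_lt (hf.integrable one_le_two) hε
    (δ := (d + 2 : ENNReal)⁻¹) (by simp)
  obtain ⟨n, hn⟩ := exists_level_dist_lt (hg.comp h.continuous) hε
  have hθ : Irrational (α * B.height (n + 1)) :=
    hirr.mul_natCast (ht.height_pos _).ne'
  obtain ⟨k, hk⟩ := (denseRange_circleExp_pow hθ).exists_le_dist hr0 hp
  have hlt : (Fintype.card (Fin (d + 1)) : ENNReal) * μ {x | c * r / 8 ≤ dist (f x) (g x)} < 1 := by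
    refine (mul_le_mul_right hμA _).trans_lt ?_
    rw [← div_eq_mul_inv, ENNReal.div_lt_iff (by simp) (by simp), one_mul, Fintype.card_fin]
    exact_mod_cast Nat.lt_succ_self (d + 1)
  obtain ⟨x, ⟨hx, hxc⟩, hxA⟩ := exists_forall_iterate_notMem hμ.toMeasurePreserving hA hlt
    (fun i => k i * B.height (n + 1)) (hiter.and hfc)
  set y : Fin (d + 1) → B.PathSpace := fun i =>
    (B.vershikMap hB)^[k i * B.height (n + 1)] (h.symm x) with hy
  have hyx (i : Fin (d + 1)) : h (y i) = T^[k i * B.height (n + 1)] x := by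
    have : Function.Semiconj h (B.vershikMap hB) T := hconj
    rw [hy, (this.iterate_right _).eq, h.apply_symm_apply]
  -- Pigeonhole: `d + 1` iterates, at most `d` vertices. Level `n + 1` is used because the rank
  -- bound excludes level `0`.
  obtain ⟨i, j, hij, hv⟩ : ∃ i j, i ≠ j ∧
      B.src ((y i).edge (n + 1)) = B.src ((y j).edge (n + 1)) := by
    refine Fintype.exists_ne_map_eq_of_card_lt (fun i => B.src ((y i).edge (n + 1))) ?_
    rw [Fintype.card_fin, ← Nat.card_eq_fintype_card]
    exact Nat.lt_succ_of_le (hr n)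
  have hyij : dist (g (h (y i))) (g (h (y j))) < c * r / 8 :=
    hn (n + 1) n.le_succ _ _ (ht.edge_eq_of_position_eq _ _ _ hv (by
      rw [hy, ht.position_iterate_vershikMap, ht.position_iterate_vershikMap]))
  rw [hyx, hyx] at hyij
  have hi := hxA i
  have hj := hxA j
  rw [Set.mem_ofPred_eq, not_le] at hi hj
  rw [dist_comm] at hj
  have hfij := (dist_triangle4 (f (T^[k i * B.height (n + 1)] x)) _ _ _).trans_lt
    (add_lt_add (add_lt_add hi hyij) hj)
  have hpow (l : ℕ) : ((Circle.exp (2 * Real.pi * α) : Circle) : ℂ) ^ (l * B.height (n + 1)) =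
      ((Circle.exp (2 * Real.pi * (α * B.height (n + 1))) ^ l : Circle) : ℂ) := by
    rw [← Circle.coe_pow, mul_comm l, pow_mul, ← Circle.exp_natCast_mul]
    congr 3
    ring
  rw [hx, hx, hpow, hpow, dist_eq_norm, ← sub_mul, norm_mul, hxc, ← dist_eq_norm] at hfij
  have hsep : r / 2 ≤ dist ((Circle.exp (2 * Real.pi * (α * B.height (n + 1))) ^ k i : Circle) : ℂ)
      ((Circle.exp (2 * Real.pi * (α * B.height (n + 1))) ^ k j : Circle) : ℂ) := hk i j hij
  -- The distance of the two values of `f` is at least `c * r / 2`, but less than `3 * (c * r / 8)`.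
  nlinarith

theorem mainTheorem9 {X : Type*} [TopologicalSpace X] [MeasurableSpace X] [BorelSpace X]
    (T : X ≃ₜ X) (hT : IsCantorMinimal T) (d : ℕ) (hd : IsToeplitzOfRank T d)
    (μ : Measure X) [IsProbabilityMeasure μ] (hμ : Ergodic T μ) :
    (∀ α : ℝ, IsMeasurableEigenvalue T μ (Complex.exp (2 * Real.pi * Complex.I * α)) →
      ∃ q : ℚ, α = q) ∧
    (∀ z : ℂ, IsMeasurableEigenvalue T μ z →
      ∃ q : ℚ, z = Complex.exp (2 * Real.pi * Complex.I * (q : ℂ))) := by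
  have := hT.compact
  have := hT.hausdorff
  obtain ⟨b, hbc, hb, -⟩ := hT.clopen_basis
  have := hb.secondCountableTopology hbc
  have := TopologicalSpace.metrizableSpace_of_t3_secondCountable X
  have real (α : ℝ) (hα : IsMeasurableEigenvalue T μ (Complex.exp (2 * Real.pi * Complex.I * α))) :
      ∃ q : ℚ, α = q := by
    have h := hd.not_irrational_of_isMeasurableEigenvalue hμ (α := α) (by
      convert hα using 1
      rw [Circle.coe_exp]
      push_cast
      ring_nf)
    obtain ⟨q, hq⟩ := not_not.1 h
    exact ⟨q, hq.symm⟩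
  refine ⟨real, fun z hz => ?_⟩
  obtain ⟨f, hf, h0, hfz⟩ := id hz
  have hz1 := norm_eigenvalue_eq_one hμ.toMeasurePreserving hf h0 hfz
  -- Since `|z| = 1`, the argument of `z` supplies a real `α` to which the first part applies.
  have hexp : z = Complex.exp (2 * Real.pi * Complex.I * (z.arg / (2 * Real.pi) : ℝ)) := by
    conv_lhs => rw [← Complex.norm_mul_exp_arg_mul_I z, hz1, Complex.ofReal_one, one_mul]
    have := Real.pi_ne_zero
    push_cast
    congr 1
    field_simp
  rw [hexp] at hz
  obtain ⟨q, hq⟩ := real _ hz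
  refine ⟨q, ?_⟩
  rw [hexp, hq, Complex.ofReal_ratCast]
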